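/- Let $M$ be a smooth connected Hausdorff paracompact manifold of dimension $n$, let $b$ be a geometric structure on $M$, that is, a smooth non-degenerate $(0,2)$-tensor field (with no symmetry assumed), and let $\mu$ and $\omega$ be volume forms on $M$, that is, smooth nowhere vanishing $n$-forms. For an open set $U\subseteq M$ and $F\in C^\infty(U,\mathbb R)$, the left- and right-gradients $\nabla^L_bF,\nabla^R_bF$ are the vector fields on $U$ uniquely determined by $$b(\nabla^L_bF,X)=\mathrm dF\cdot X,\qquad b(X,\nabla^R_bF)=\mathrm dF\cdot X\qquad\text{for all vector fields }X\text{ on }U.$$ The $b$-bracket is $\{F,G\}_b:=b(\nabla^L_bF,\nabla^L_bG)=b(\nabla^R_bF,\nabla^R_bG)$; the divergence $\operatorname{div}_\mu X$ of a vector field $X$ is the function with $\mathcal L_X\mu=(\operatorname{div}_\mu X)\,\mu$; and the left- and right-Laplacians are $\Delta^L_{b,\mu}F:=\operatorname{div}_\mu(\nabla^L_bF)$ and $\Delta^R_{b,\mu}F:=\operatorname{div}_\mu(\nabla^R_bF)$. Then there is a unique function $f:M\to\mathbb R$ with $\omega=f\mu$; it is smooth and nowhere vanishing, and for every open set $U\subseteq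 M$ and every $F\in C^\infty(U,\mathbb R)$ one has on $U$ $$\Delta^L_{b,\omega}F=\Delta^L_{b,\mu}F+\frac1f\,\{f,F\}_b,\qquad \Delta^R_{b,\omega}F=\Delta^R_{b,\mu}F+\frac1f\,\{F,f\}_b .$$ -/

import Mathlib

open Set Module
open scoped Manifold ContDiff Topology Bundle

noncomputable section

namespace GeomLaplace

/-! ### Linear algebra -/

/-- The derivation `A · η` induced on alternating `k`-forms by an endomorphism `A`:
`(A · η)(v₁, …, v_k) = ∑ i, η(v₁, …, A vᵢ, …, v_k)`. -/
def derivationAction {E : Type*} [NormedAddCommGroup E] [NormedSpace ℝ E] {k : ℕ}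
    (A : E →L[ℝ] E) (η : E [⋀^Fin k]→L[ℝ] ℝ) : E [⋀^Fin k]→L[ℝ] ℝ :=
  { toContinuousMultilinearMap :=
      ∑ i : Fin k, η.toContinuousMultilinearMap.compContinuousLinearMap
        (fun j => if j = i then A else ContinuousLinearMap.id ℝ E)
    map_eq_zero_of_eq' := by
      intro v i j hv hij
      have key : ∀ l : Fin k, (η.toContinuousMultilinearMap.compContinuousLinearMap
          (fun m => if m = l then A else ContinuousLinearMap.id ℝ E)) v
          = η (Function.update v l (A (v l))) := by
        intro l
        simp only [ContinuousMultilinearMap.compContinuousLinearMap_apply,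
          ContinuousAlternatingMap.coe_toContinuousMultilinearMap]
        congr 1
        funext m
        by_cases h : m = l
        · subst h; simp
        · simp [h]
      have hsum : (∑ l : Fin k, η.toContinuousMultilinearMap.compContinuousLinearMap
          (fun m => if m = l then A else ContinuousLinearMap.id ℝ E)) v
          = ∑ l : Fin k, η (Function.update v l (A (v l))) := by
        rw [sum_apply]
        exact Finset.sum_congr rfl fun l _ => key l
      show (∑ l : Fin k, η.toContinuousMultilinearMap.compContinuousLinearMap
          (fun m => if m = l then A else ContinuousLinearMap.id ℝ E)) v = 0
      rw [hsum, ← Finset.add_sum_erase _ _ (Finset.mem_univ i),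
        ← Finset.add_sum_erase _ _ (Finset.mem_erase.2 ⟨hij.symm, Finset.mem_univ j⟩),
        Finset.sum_eq_zero, add_zero]
      · have hsw : Function.update v j (A (v j)) =
            Function.update v i (A (v i)) ∘ Equiv.swap i j := by
          funext m
          by_cases hmi : m = i
          · subst hmi; simp [hij, hij.symm, hv]
          · by_cases hmj : m = j
            · subst hmj; simp [hv]
            · simp [hmi, hmj, Equiv.swap_apply_of_ne_of_ne hmi hmj]
        have hs := η.toAlternatingMap.map_swap (Function.update v i (A (v i))) hij
        have hs' : η (Function.update v i (A (v i)) ∘ Equiv.swap i j) =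
            - η (Function.update v i (A (v i))) := hs
        rw [hsw, hs', add_neg_cancel]
      · intro l hl
        simp only [Finset.mem_erase, Finset.mem_univ, and_true] at hl
        refine η.map_eq_zero_of_eq _ (i := i) (j := j) ?_ hij
        simp [Ne.symm hl.1, Ne.symm hl.2, hv] }

theorem derivationAction_apply {E : Type*} [NormedAddCommGroup E] [NormedSpace ℝ E] {k : ℕ}
    (A : E →L[ℝ] E) (η : E [⋀^Fin k]→L[ℝ] ℝ) (v : Fin k → E) :
    derivationAction A η v = ∑ i, η (Function.update v i (A (v i))) := by
  show (∑ l : Fin k, η.toContinuousMultilinearMap.compContinuousLinearMap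
          (fun m => if m = l then A else ContinuousLinearMap.id ℝ E)) v = _
  rw [sum_apply]
  refine Finset.sum_congr rfl fun l _ => ?_
  simp only [ContinuousMultilinearMap.compContinuousLinearMap_apply,
    ContinuousAlternatingMap.coe_toContinuousMultilinearMap]
  congr 1
  funext m
  by_cases h : m = l
  · subst h; simp
  · simp [h]

/-- On an `n`-dimensional space, every alternating `n`-form is a unique multiple of a given
nonzero one. -/
theorem existsUnique_eq_smul {V : Type*} [AddCommGroup V] [Module ℝ V] [TopologicalSpace V]
    {n : ℕ} (e : Basis (Fin n) ℝ V) (ν η : V [⋀^Fin n]→L[ℝ] ℝ) (hν : ν ≠ 0) :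
    ∃! c : ℝ, η = c • ν := by
  have h0 : ν e ≠ 0 := by
    intro h
    apply hν
    have : ν.toAlternatingMap = 0 := by
      rw [ν.toAlternatingMap.eq_smul_basis_det e]
      have : ν.toAlternatingMap e = 0 := h
      rw [this, zero_smul]
    ext v
    exact DFunLike.congr_fun this v
  refine ⟨η e / ν e, ?_, ?_⟩
  · have h1 := η.toAlternatingMap.eq_smul_basis_det e
    have h2 := ν.toAlternatingMap.eq_smul_basis_det e
    ext v
    have h1v : η v = η e * e.det v := DFunLike.congr_fun h1 v
    have h2v : ν v = ν e * e.det v := DFunLike.congr_fun h2 v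
    rw [ContinuousAlternatingMap.smul_apply, smul_eq_mul, h1v, h2v]
    field_simp
  · intro c hc
    rw [hc]
    simp [h0]

/-- A linear functional on a finite-dimensional space is represented by a unique vector with
respect to a bilinear form with trivial left kernel. -/
theorem existsUnique_represents {V : Type*} [AddCommGroup V] [Module ℝ V] [FiniteDimensional ℝ V]
    (B : V →ₗ[ℝ] V →ₗ[ℝ] ℝ) (hB : ∀ v, (∀ w, B v w = 0) → v = 0) (α : V →ₗ[ℝ] ℝ) :
    ∃! v : V, ∀ w, B v w = α w := by
  have hinj : Function.Injective B := by
    rw [injective_iff_map_eq_zero]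
    intro v hv
    exact hB v fun w => by rw [hv]; rfl
  have hsurj : Function.Surjective B :=
    (LinearMap.injective_iff_surjective_of_finrank_eq_finrank
      (Subspace.dual_finrank_eq (K := ℝ) (V := V)).symm).1 hinj
  obtain ⟨v, hv⟩ := hsurj α
  refine ⟨v, fun w => by rw [hv], fun u hu => hinj ?_⟩
  rw [hv]
  exact LinearMap.ext hu

/-! ### Geometric structures and volume forms on a manifold

The dimension is `n`, and the model space of the manifold is `ℝⁿ = EuclideanSpace ℝ (Fin n)`. -/

section Manifold

variable {n : ℕ} {H : Type*} [TopologicalSpace H]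
  (I : ModelWithCorners ℝ (EuclideanSpace ℝ (Fin n)) H)
  (M : Type*) [TopologicalSpace M] [ChartedSpace H M] [IsManifold I ∞ M]

/-- A geometric structure: a smooth non-degenerate `(0,2)`-tensor field, with no symmetry
assumption. -/
structure GeometricStructure where
  /-- the bilinear form on each tangent space -/
  toFun : ∀ p : M, TangentSpace I p →L[ℝ] TangentSpace I p →L[ℝ] ℝ
  /-- smoothness, as a section of the bundle of bilinear forms on the tangent spaces -/
  contMDiff : ContMDiff I
    (I.prod 𝓘(ℝ, EuclideanSpace ℝ (Fin n) →L[ℝ] EuclideanSpace ℝ (Fin n) →L[ℝ] ℝ)) ∞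
    (fun p => Bundle.TotalSpace.mk'
      (EuclideanSpace ℝ (Fin n) →L[ℝ] EuclideanSpace ℝ (Fin n) →L[ℝ] ℝ)
      (E := fun q : M => TangentSpace I q →L[ℝ] TangentSpace I q →L[ℝ] ℝ) p (toFun p))
  /-- the left kernel is trivial -/
  separatingLeft : ∀ (p : M) (v : TangentSpace I p), (∀ w, toFun p v w = 0) → v = 0
  /-- the right kernel is trivial -/
  separatingRight : ∀ (p : M) (w : TangentSpace I p), (∀ v, toFun p v w = 0) → w = 0

/-- A volume form: a smooth, nowhere vanishing differential form of top degree `n`. -/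
structure VolumeForm where
  /-- the alternating `n`-form on each tangent space -/
  toFun : ∀ p : M, TangentSpace I p [⋀^Fin n]→L[ℝ] ℝ
  /-- smoothness, as a section of the bundle of alternating `n`-forms on the tangent spaces -/
  contMDiff : ContMDiff I
    (I.prod 𝓘(ℝ, EuclideanSpace ℝ (Fin n) [⋀^Fin n]→L[ℝ] ℝ)) ∞
    (fun p => Bundle.TotalSpace.mk' (EuclideanSpace ℝ (Fin n) [⋀^Fin n]→L[ℝ] ℝ)
      (E := fun q : M => TangentSpace I q [⋀^Fin n]→L[ℝ] Bundle.Trivial M ℝ q) p (toFun p))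
  ne_zero : ∀ p, toFun p ≠ 0

end Manifold

section Operators

variable {n : ℕ} {H : Type*} [TopologicalSpace H]
  {I : ModelWithCorners ℝ (EuclideanSpace ℝ (Fin n)) H}
  {M : Type*} [TopologicalSpace M] [ChartedSpace H M]

instance (p : M) : FiniteDimensional ℝ (TangentSpace I p) :=
  inferInstanceAs (FiniteDimensional ℝ (EuclideanSpace ℝ (Fin n)))

/-! ### Lie derivative of differential forms -/

variable (I) in
/-- The derivative at `p` of the preferred chart at `p`. -/
def chartDeriv (p : M) : TangentSpace I p →L[ℝ] EuclideanSpace ℝ (Fin n) :=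
  mfderiv I 𝓘(ℝ, EuclideanSpace ℝ (Fin n)) (extChartAt I p) p

variable (I) in
/-- The derivative at `y` of the inverse of the preferred chart at `p`. -/
def chartSymmDeriv (p : M) (y : EuclideanSpace ℝ (Fin n)) :
    EuclideanSpace ℝ (Fin n) →L[ℝ] TangentSpace I ((extChartAt I p).symm y) :=
  mfderivWithin 𝓘(ℝ, EuclideanSpace ℝ (Fin n)) I (extChartAt I p).symm (range I) y

variable (I) in
/-- The representation, in the preferred chart at `p`, of a field `η` of alternating `k`-forms:
the pullback of `η` under the inverse of the chart. -/
def formInChart {k : ℕ} (η : ∀ q : M, TangentSpace I q [⋀^Fin k]→L[ℝ] ℝ) (p : M)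
    (y : EuclideanSpace ℝ (Fin n)) : EuclideanSpace ℝ (Fin n) [⋀^Fin k]→L[ℝ] ℝ :=
  (η ((extChartAt I p).symm y)).compContinuousLinearMap (chartSymmDeriv I p y)

variable (I) in
/-- The representation, in the preferred chart at `p`, of a vector field `X`: the pullback of `X`
under the inverse of the chart. -/
def fieldInChart (X : ∀ q : M, TangentSpace I q) (p : M) (y : EuclideanSpace ℝ (Fin n)) :
    EuclideanSpace ℝ (Fin n) :=
  (chartSymmDeriv I p y).inverse (X ((extChartAt I p).symm y))

/-- The Lie derivative, along a vector field `X`, of a field `η` of alternating `k`-forms on an open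
subset of a Euclidean space (or of a half-space, …, in which case derivatives are taken within the
set `s`):
`(L_X η)(v₁, …, v_k) = (D_X η)(v₁, …, v_k) + ∑ i, η(v₁, …, DX(vᵢ), …, v_k)`,
i.e. `X(η(v₁, …, v_k)) - ∑ i, η(v₁, …, [X, vᵢ], …, v_k)` for constant fields `vᵢ`. -/
def modelLieDerivative {E : Type*} [NormedAddCommGroup E] [NormedSpace ℝ E] {k : ℕ}
    (X : E → E) (η : E → E [⋀^Fin k]→L[ℝ] ℝ) (s : Set E) (y : E) : E [⋀^Fin k]→L[ℝ] ℝ :=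
  fderivWithin ℝ η s y (X y) + derivationAction (fderivWithin ℝ X s y) (η y)

variable (I) in
/-- The Lie derivative `L_X η` at `p` of a field `η` of alternating `k`-forms along a vector field
`X`. As for the Lie bracket of vector fields in Mathlib, it is computed in the preferred chart at
`p` and pulled back to `T_p M`. -/
def lieDerivative {k : ℕ} (X : ∀ q : M, TangentSpace I q)
    (η : ∀ q : M, TangentSpace I q [⋀^Fin k]→L[ℝ] ℝ) (p : M) :
    TangentSpace I p [⋀^Fin k]→L[ℝ] ℝ :=
  (modelLieDerivative (fieldInChart I X p) (formInChart I η p) (range I)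
    (extChartAt I p p)).compContinuousLinearMap (chartDeriv I p)

variable [IsManifold I ∞ M]

theorem VolumeForm.existsUnique_eq_smul (μ : VolumeForm I M) (p : M)
    (η : TangentSpace I p [⋀^Fin n]→L[ℝ] ℝ) : ∃! c : ℝ, η = c • μ.toFun p :=
  GeomLaplace.existsUnique_eq_smul
    (V := TangentSpace I p) (EuclideanSpace.basisFun (Fin n) ℝ).toBasis (μ.toFun p) η (μ.ne_zero p)

/-- The divergence of `X` with respect to `μ`: the unique function with
`L_X μ = (div_μ X) μ`. -/
def VolumeForm.divergence (μ : VolumeForm I M) (X : ∀ q : M, TangentSpace I q) (p : M) : ℝ :=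
  (μ.existsUnique_eq_smul p (lieDerivative I X μ.toFun p)).choose

theorem VolumeForm.lieDerivative_eq (μ : VolumeForm I M) (X : ∀ q : M, TangentSpace I q) (p : M) :
    lieDerivative I X μ.toFun p = μ.divergence X p • μ.toFun p :=
  (μ.existsUnique_eq_smul p (lieDerivative I X μ.toFun p)).choose_spec.1

/-! ### Gradients, bracket and Laplacians -/

namespace GeometricStructure

theorem existsUnique_leftGrad (b : GeometricStructure I M) (F : M → ℝ) (p : M) :
    ∃! v : TangentSpace I p, ∀ w, b.toFun p v w = mvfderiv I F p w :=
  existsUnique_represents (V := TangentSpace I p)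
    (LinearMap.mk₂ ℝ (fun v w => b.toFun p v w) (by simp) (by simp) (by simp) (by simp))
    (fun v hv => b.separatingLeft p v hv) (mvfderiv I F p).toLinearMap

theorem existsUnique_rightGrad (b : GeometricStructure I M) (F : M → ℝ) (p : M) :
    ∃! v : TangentSpace I p, ∀ w, b.toFun p w v = mvfderiv I F p w :=
  existsUnique_represents (V := TangentSpace I p)
    (LinearMap.mk₂ ℝ (fun v w => b.toFun p w v) (by simp) (by simp) (by simp) (by simp))
    (fun v hv => b.separatingRight p v hv) (mvfderiv I F p).toLinearMap

/-- The left-gradient of `F`: the unique vector field with `b(∇ᴸF, X) = dF(X)` for all `X`. -/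
def leftGrad (b : GeometricStructure I M) (F : M → ℝ) (p : M) : TangentSpace I p :=
  (b.existsUnique_leftGrad F p).choose

/-- The right-gradient of `F`: the unique vector field with `b(X, ∇ᴿF) = dF(X)` for all `X`. -/
def rightGrad (b : GeometricStructure I M) (F : M → ℝ) (p : M) : TangentSpace I p :=
  (b.existsUnique_rightGrad F p).choose

theorem leftGrad_spec (b : GeometricStructure I M) (F : M → ℝ) (p : M) (w : TangentSpace I p) :
    b.toFun p (b.leftGrad F p) w = mvfderiv I F p w :=
  (b.existsUnique_leftGrad F p).choose_spec.1 w

theorem rightGrad_spec (b : GeometricStructure I M) (F : M → ℝ) (p : M) (w : TangentSpace I p) :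
    b.toFun p w (b.rightGrad F p) = mvfderiv I F p w :=
  (b.existsUnique_rightGrad F p).choose_spec.1 w

/-- The bracket `{F, G}_b = b(∇ᴸF, ∇ᴸG)`. -/
def bracket (b : GeometricStructure I M) (F G : M → ℝ) (p : M) : ℝ :=
  b.toFun p (b.leftGrad F p) (b.leftGrad G p)

/-- The bracket is also given by the right-gradients: `{F, G}_b = b(∇ᴿF, ∇ᴿG)`. -/
theorem bracket_eq_rightGrad (b : GeometricStructure I M) (F G : M → ℝ) (p : M) :
    b.bracket F G p = b.toFun p (b.rightGrad F p) (b.rightGrad G p) := by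
  rw [bracket, leftGrad_spec, ← rightGrad_spec, leftGrad_spec, rightGrad_spec]

/-- The left-Laplacian `Δᴸ_{b,μ} F = div_μ (∇ᴸF)`. -/
def leftLaplacian (b : GeometricStructure I M) (μ : VolumeForm I M) (F : M → ℝ) (p : M) : ℝ :=
  μ.divergence (b.leftGrad F) p

/-- The right-Laplacian `Δᴿ_{b,μ} F = div_μ (∇ᴿF)`. -/
def rightLaplacian (b : GeometricStructure I M) (μ : VolumeForm I M) (F : M → ℝ) (p : M) : ℝ :=
  μ.divergence (b.rightGrad F) p

end GeometricStructure

end Operators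

end GeomLaplace

end

namespace GeomLaplace

/-! Top-degree forms at a point span a line, so `ν = f μ` with a unique `f`. In a chart, `f` is a
quotient of coefficients of `ν` and `μ`, hence smooth. The core is the Leibniz rule `L_X (f μ) = f
L_X μ + df(X) μ` (`VolumeForm.lieDerivative_eq_add`). Comparing coefficients of `μ` gives `div_ν X =
div_μ X + df(X) / f` (`VolumeForm.divergence_eq_add`). For `X = ∇ᴸF` the extra term is `df(∇ᴸF) =
b(∇ᴸf, ∇ᴸF) = {f, F}`; for `X = ∇ᴿF` it is `df(∇ᴿF) = b(∇ᴿF, ∇ᴿf) = {F, f}`. The side on which the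
gradient sits in `b` decides the order in the bracket. -/

theorem derivationAction_smul {E : Type*} [NormedAddCommGroup E] [NormedSpace ℝ E] {k : ℕ}
    (A : E →L[ℝ] E) (c : ℝ) (η : E [⋀^Fin k]→L[ℝ] ℝ) :
    derivationAction A (c • η) = c • derivationAction A η := by
  ext v
  simp [derivationAction_apply, Finset.mul_sum]

theorem apply_basis_ne_zero {V : Type*} [AddCommGroup V] [Module ℝ V] [TopologicalSpace V]
    {n : ℕ} (e : Basis (Fin n) ℝ V) {ν : V [⋀^Fin n]→L[ℝ] ℝ} (hν : ν ≠ 0) : ν e ≠ 0 := by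
  intro h
  apply hν
  ext v
  have hv : ν v = ν e * e.det v :=
    DFunLike.congr_fun (ν.toAlternatingMap.eq_smul_basis_det e) v
  simp [hv, h]

section Manifold

variable {n : ℕ} {H : Type*} [TopologicalSpace H]
  {I : ModelWithCorners ℝ (EuclideanSpace ℝ (Fin n)) H}
  {M : Type*} [TopologicalSpace M] [ChartedSpace H M]

/-! ### Forms and vector fields read in a chart -/

theorem formInChart_eq_smul {k : ℕ} {η ζ : ∀ q : M, TangentSpace I q [⋀^Fin k]→L[ℝ] ℝ}
    {f : M → ℝ} (h : ∀ q, ζ q = f q • η q) (p : M) (y : EuclideanSpace ℝ (Fin n)) :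
    formInChart I ζ p y = f ((extChartAt I p).symm y) • formInChart I η p y := by
  simp only [formInChart, h]
  rfl

/-- The chart at `p` identifies `η` read at the image of `p` with `η p`. -/
theorem formInChart_compContinuousLinearMap_chartDeriv [IsManifold I ∞ M] {k : ℕ}
    (η : ∀ q : M, TangentSpace I q [⋀^Fin k]→L[ℝ] ℝ) (p : M) :
    (formInChart I η p (extChartAt I p p)).compContinuousLinearMap (chartDeriv I p) = η p := by
  have hcomp := mfderivWithin_extChartAt_symm_comp_mfderiv_extChartAt' (I := I)
    (mem_extChartAt_source (I := I) p)
  have hp : (extChartAt I p).symm (extChartAt I p p) = p := extChartAt_to_inv p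
  -- The type of `η q` depends on `q`, so the equality of base points is eliminated for a variable
  -- `q`; all fibres are definitionally `ℝⁿ`.
  have key : ∀ q : M, q = p → ∀ w : Fin k → EuclideanSpace ℝ (Fin n), η q w = η p w := by
    rintro q rfl w
    rfl
  ext v
  refine (key _ hp _).trans (congrArg (η p) (funext fun i => ?_))
  exact DFunLike.congr_fun hcomp (v i)

/-- In Mathlib's convention, the preferred chart at `p` induces the identity on `T_p M = ℝⁿ`. -/
theorem fieldInChart_extChartAt_self [IsManifold I ∞ M] (X : ∀ q : M, TangentSpace I q) (p : M) :
    fieldInChart I X p (extChartAt I p p) = X p := by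
  have h1 := TangentBundle.symmL_trivializationAt (I := I) (mem_chart_source H p)
  rw [TangentBundle.symmL_trivializationAt_eq_core (mem_chart_source H p)] at h1
  -- This derivative is the coordinate change of the tangent bundle core from the chart at `p` to
  -- itself.
  have hA : chartSymmDeriv I p (extChartAt I p p) =
      ContinuousLinearMap.id ℝ (EuclideanSpace ℝ (Fin n)) := by
    refine h1.symm.trans (ContinuousLinearMap.ext fun v => ?_)
    exact (tangentBundleCore I M).coordChange_self (achart H p) p (mem_chart_source H p) v
  have key : ∀ q : M, q = p → (X q : EuclideanSpace ℝ (Fin n)) = X p := by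
    rintro q rfl
    rfl
  have hinv : (ContinuousLinearMap.id ℝ (EuclideanSpace ℝ (Fin n))).inverse =
      ContinuousLinearMap.id ℝ (EuclideanSpace ℝ (Fin n)) := ContinuousLinearMap.inverse_id
  refine (congrArg (fun A : EuclideanSpace ℝ (Fin n) →L[ℝ] EuclideanSpace ℝ (Fin n) =>
    A.inverse (X ((extChartAt I p).symm (extChartAt I p p)))) hA).trans ?_
  exact (DFunLike.congr_fun hinv _).trans (key _ (extChartAt_to_inv p))

theorem VolumeForm.formInChart_ne_zero [IsManifold I ∞ M] (μ : VolumeForm I M) (p : M) :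
    formInChart I μ.toFun p (extChartAt I p p) ≠ 0 := by
  intro h
  apply μ.ne_zero p
  rw [← formInChart_compContinuousLinearMap_chartDeriv μ.toFun p, h]
  rfl

/-- A volume form read in the chart at `p` depends smoothly on the point near `p`. -/
theorem VolumeForm.contMDiffAt_formInChart [IsManifold I ∞ M] (μ : VolumeForm I M) (p : M) :
    ContMDiffAt I 𝓘(ℝ, EuclideanSpace ℝ (Fin n) [⋀^Fin n]→L[ℝ] ℝ) ∞
      (fun q => formInChart I μ.toFun p (extChartAt I p q)) p := by
  -- On the chart domain, `formInChart` is the coordinate of the section in the bundle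
  -- trivialization at `p`, because the inverse tangent trivialization is the derivative of the
  -- inverse chart.
  refine (Bundle.contMDiffAt_totalSpace.1 (μ.contMDiff p)).2.congr_of_eventuallyEq ?_
  filter_upwards [chart_source_mem_nhds H p] with q hq
  have hs : (extChartAt I p).symm (extChartAt I p q) = q :=
    (extChartAt I p).left_inv (by simpa using hq)
  have key : ∀ q' : M, q' = q → ∀ w : Fin n → EuclideanSpace ℝ (Fin n),
      μ.toFun q' w = μ.toFun q w := by
    rintro q' rfl w
    rfl
  have hL := TangentBundle.symmL_trivializationAt (I := I) hq
  ext v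
  refine (key _ hs _).trans ?_
  rw [FiberBundle.trivializationAt_continuousAlternatingMap_apply]
  refine (congrArg (μ.toFun q)
    (funext fun i => (DFunLike.congr_fun hL (v i)).symm)).trans (Eq.symm ?_)
  simp only [ContinuousAlternatingMap.inCoordinates]
  exact DFunLike.congr_fun (Bundle.Trivial.continuousLinearMapAt_trivialization ℝ M ℝ q) _

theorem VolumeForm.differentiableWithinAt_formInChart [IsManifold I ∞ M] (μ : VolumeForm I M)
    (p : M) :
    DifferentiableWithinAt ℝ (formInChart I μ.toFun p) (range I) (extChartAt I p p) := by
  have h := (contMDiffAt_iff.1 (μ.contMDiffAt_formInChart p)).2.differentiableWithinAt (by simp)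
  refine h.congr_of_eventuallyEq ?_ ?_
  · filter_upwards [extChartAt_target_mem_nhdsWithin (I := I) p] with y hy
    change _ = formInChart I μ.toFun p (extChartAt I p ((extChartAt I p).symm y))
    rw [(extChartAt I p).right_inv hy]
  · change _ = formInChart I μ.toFun p (extChartAt I p ((extChartAt I p).symm _))
    rw [extChartAt_to_inv]

/-- Near `p`, `f` is the quotient of the chart readings of `ν` and `μ` on the standard basis; the
denominator is nonzero at `p`, hence nearby by continuity. -/
theorem VolumeForm.contMDiff_of_eq_smul [IsManifold I ∞ M] {μ ν : VolumeForm I M} {f : M → ℝ}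
    (h : ∀ q, ν.toFun q = f q • μ.toFun q) : ContMDiff I 𝓘(ℝ, ℝ) ∞ f := by
  intro p
  set e := (EuclideanSpace.basisFun (Fin n) ℝ).toBasis
  have happ (η : VolumeForm I M) : ContMDiffAt I 𝓘(ℝ, ℝ) ∞
      (fun q => formInChart I η.toFun p (extChartAt I p q) e) p :=
    (ContinuousAlternatingMap.apply ℝ (EuclideanSpace ℝ (Fin n)) ℝ
      (e : Fin n → _)).contMDiff.contMDiffAt.comp p (η.contMDiffAt_formInChart p)
  have h0 := apply_basis_ne_zero e (μ.formInChart_ne_zero p)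
  refine ((happ ν).div₀ (happ μ) h0).congr_of_eventuallyEq ?_
  filter_upwards [(happ μ).continuousAt.eventually_ne h0, extChartAt_source_mem_nhds (I := I) p]
    with q hq hqs
  simp only [Pi.div_apply, formInChart_eq_smul h, (extChartAt I p).left_inv hqs,
    ContinuousAlternatingMap.smul_apply, smul_eq_mul]
  field_simp

/-! ### Change of volume form in the Lie derivative and the divergence -/

/-- `L_X (f μ) = f L_X μ + df(X) μ`. -/
theorem VolumeForm.lieDerivative_eq_add [IsManifold I ∞ M] {μ ν : VolumeForm I M} {f : M → ℝ}
    (h : ∀ q, ν.toFun q = f q • μ.toFun q) (X : ∀ q : M, TangentSpace I q) (p : M) :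
    lieDerivative I X ν.toFun p =
      f p • lieDerivative I X μ.toFun p + mvfderiv I f p (X p) • μ.toFun p := by
  have hf : MDifferentiableAt I 𝓘(ℝ, ℝ) f p :=
    (VolumeForm.contMDiff_of_eq_smul h).mdifferentiable (by simp) p
  have hfd : DifferentiableWithinAt ℝ (f ∘ (extChartAt I p).symm) (range I) (extChartAt I p p) :=
    ((mdifferentiableAt_iff _ _).1 hf).2
  have hu : UniqueDiffWithinAt ℝ (range I) (extChartAt I p p) :=
    I.uniqueDiffOn _ (mem_range_self _)
  have hν : formInChart I ν.toFun p =
      fun y => (f ∘ (extChartAt I p).symm) y • formInChart I μ.toFun p y :=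
    funext (formInChart_eq_smul h p)
  have hdf : fderivWithin ℝ (f ∘ (extChartAt I p).symm) (range I) (extChartAt I p p)
      (fieldInChart I X p (extChartAt I p p)) = mvfderiv I f p (X p) := by
    rw [fieldInChart_extChartAt_self, mvfderiv, hf.mfderiv]
    rfl
  conv_rhs => rw [← formInChart_compContinuousLinearMap_chartDeriv μ.toFun p]
  ext v
  simp only [lieDerivative, modelLieDerivative, hν]
  -- Only the derivative of the form produces a `df` term. The `DX` term is linear in the form,
  -- whatever value `fderivWithin` assigns to `DX`, so `X` may be arbitrary.
  rw [fderivWithin_fun_smul hu hfd (μ.differentiableWithinAt_formInChart p), derivationAction_smul]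
  simp only [ContinuousAlternatingMap.compContinuousLinearMap_apply, hdf,
    ContinuousAlternatingMap.add_apply, ContinuousAlternatingMap.smul_apply, add_apply,
    smul_apply, ContinuousLinearMap.smulRight_apply, Function.comp_apply, extChartAt_to_inv,
    smul_eq_mul]
  ring

theorem VolumeForm.divergence_eq_add [IsManifold I ∞ M] {μ ν : VolumeForm I M} {f : M → ℝ}
    (h : ∀ q, ν.toFun q = f q • μ.toFun q) (X : ∀ q : M, TangentSpace I q) (p : M) :
    ν.divergence X p = μ.divergence X p + 1 / f p * mvfderiv I f p (X p) := by
  have hf : f p ≠ 0 := fun h0 => ν.ne_zero p (by rw [h, h0, zero_smul])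
  have hL := VolumeForm.lieDerivative_eq_add h X p
  rw [ν.lieDerivative_eq, μ.lieDerivative_eq, h, smul_smul, smul_smul, ← add_smul] at hL
  -- Cancelling `μ p` leaves `div_ν X * f = f * div_μ X + df(X)` at `p`, up to the order of factors.
  have := smul_left_injective ℝ (μ.ne_zero p) hL
  field_simp
  linarith

end Manifold

end GeomLaplace

theorem proposition4p2 {n : ℕ} {H : Type*} [TopologicalSpace H]
    (I : ModelWithCorners ℝ (EuclideanSpace ℝ (Fin n)) H)
    (M : Type*) [TopologicalSpace M] [ChartedSpace H M] [IsManifold I ∞ M]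
    [T2Space M] [ParacompactSpace M] [ConnectedSpace M]
    (b : GeomLaplace.GeometricStructure I M) (μ ν : GeomLaplace.VolumeForm I M) :
    ∃ f : M → ℝ,
      ContMDiff I 𝓘(ℝ, ℝ) ∞ f ∧ (∀ p, f p ≠ 0) ∧
      (∀ p, ν.toFun p = f p • μ.toFun p) ∧
      (∀ g : M → ℝ, (∀ p, ν.toFun p = g p • μ.toFun p) → g = f) ∧
      ∀ U : Set M, IsOpen U → ∀ F : M → ℝ, ContMDiffOn I 𝓘(ℝ, ℝ) ∞ F U → ∀ p ∈ U,
        b.leftLaplacian ν F p = b.leftLaplacian μ F p + 1 / f p * b.bracket f F p ∧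
        b.rightLaplacian ν F p = b.rightLaplacian μ F p + 1 / f p * b.bracket F f p := by

  choose f hf hfu using fun p => μ.existsUnique_eq_smul p (ν.toFun p)
  have hf : ∀ p, ν.toFun p = f p • μ.toFun p := hf
  refine ⟨f, GeomLaplace.VolumeForm.contMDiff_of_eq_smul hf,
    fun p h0 => ν.ne_zero p (by rw [hf, h0, zero_smul]), hf,
    fun g hg => funext fun p => hfu p (g p) (hg p), fun U _ F _ p _ => ⟨?_, ?_⟩⟩
  · rw [GeomLaplace.GeometricStructure.leftLaplacian,
      GeomLaplace.VolumeForm.divergence_eq_add hf, ← b.leftGrad_spec]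
    rfl
  · rw [GeomLaplace.GeometricStructure.rightLaplacian,
      -- `df(∇ᴿF)` becomes `b(∇ᴿF, ∇ᴿf)`, which is the bracket only in its right-gradient form.
      GeomLaplace.VolumeForm.divergence_eq_add hf, ← b.rightGrad_spec, b.bracket_eq_rightGrad]
    rfl
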